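/- Let $X$ be a real Hilbert space and let $A,B\colon X\rightrightarrows X$ be maximally monotone set-valued operators. Write $\operatorname{dom}A=\{x\in X : Ax\neq\varnothing\}$ and $\operatorname{ran}A=\bigcup_{x\in X}Ax$, and set $D=\operatorname{dom}A-\operatorname{dom}B$ and $R=\operatorname{ran}A+\operatorname{ran}B$. With $J_A=(\operatorname{Id}+A)^{-1}$, $J_B=(\operatorname{Id}+B)^{-1}$ and $R_A=2J_A-\operatorname{Id}$, let $T=\operatorname{Id}-J_A+J_BR_A$ be the Douglas--Rachford operator. Let $$v=P_{\overline{\operatorname{ran}}(\operatorname{Id}-T)}(0),\qquad v_D=P_{\overline{D}}(0),\qquad v_R=P_{\overline{R}}(0),$$ where $P_C$ denotes the projection onto the nonempty closed convex set $C$. Assume that $$\overline{\operatorname{ran}}(\operatorname{Id}-T)=\overline{D\cap R}=\overline{D}\cap\overline{R}.$$ Let $Z=\{x\in X : 0\in -v+Ax+B(x-v)\}$ be the solution set of the normal problem, and let $\widetilde Z=\{x\in X : 0\in -v_R+Ax+B(x-v_D)\}$. Then the following hold: (i) $\widetilde Z\subseteq Z$. (ii) If $v_R=0$, then $\widetilde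 Z=Z$. -/

import Mathlib

open scoped Pointwise

namespace DouglasRachford

/-- `p` is a projection (nearest point) of `x` onto `C`. -/
def IsProj {X : Type*} [NormedAddCommGroup X] (C : Set X) (x p : X) : Prop :=
  p ∈ C ∧ ∀ y ∈ C, ‖x - p‖ ≤ ‖x - y‖

/-- The projector `P_C`. It is the nearest point map when `C` is nonempty, closed and convex
(see `isProj_proj` and `IsProj.eq`). -/
noncomputable def proj {X : Type*} [NormedAddCommGroup X] (C : Set X) (x : X) : X :=
  Classical.epsilon (IsProj C x)

section

variable {X : Type*} [NormedAddCommGroup X] [InnerProductSpace ℝ X]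

theorem isProj_proj [CompleteSpace X] {C : Set X} (hne : C.Nonempty) (hcl : IsClosed C)
    (hcv : Convex ℝ C) (x : X) : IsProj C x (proj C x) := by
  obtain ⟨p, hp, hmin⟩ := exists_norm_eq_iInf_of_complete_convex hne hcl.isComplete hcv x
  refine Classical.epsilon_spec (p := IsProj C x) ⟨p, hp, fun y hy => ?_⟩
  rw [hmin]
  exact ciInf_le ⟨0, by rintro _ ⟨z, rfl⟩; exact norm_nonneg _⟩ (⟨y, hy⟩ : C)

theorem IsProj.eq {C : Set X} (hcv : Convex ℝ C) {x p q : X} (hp : IsProj C x p)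
    (hq : IsProj C x q) : p = q := by
  have hm : (1 / 2 : ℝ) • p + (1 / 2 : ℝ) • q ∈ C :=
    hcv hp.1 hq.1 (by norm_num) (by norm_num) (by norm_num)
  have h1 : ‖x - p‖ = ‖x - q‖ := le_antisymm (hp.2 q hq.1) (hq.2 p hp.1)
  have h2 := hp.2 _ hm
  have h3 := parallelogram_law_with_norm ℝ (x - p) (x - q)
  have h4 : (x - p) + (x - q) = (2 : ℝ) • (x - ((1 / 2 : ℝ) • p + (1 / 2 : ℝ) • q)) := by
    module
  rw [h4, norm_smul, Real.norm_of_nonneg (by norm_num : (0 : ℝ) ≤ 2)] at h3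
  have h5 : ‖x - p - (x - q)‖ = 0 := by
    have := norm_nonneg (x - p)
    have := norm_nonneg (x - p - (x - q))
    nlinarith
  have h6 := norm_eq_zero.1 h5
  rw [sub_sub_sub_cancel_left] at h6
  exact (sub_eq_zero.1 h6).symm

/-- Monotonicity of a set-valued operator `A : X ⇉ X`. -/
def IsMonotone (A : X → Set X) : Prop :=
  ∀ x y : X, ∀ u ∈ A x, ∀ w ∈ A y, 0 ≤ inner ℝ (x - y) (u - w)

/-- `A` is maximally monotone: it is monotone, and no monotone operator has a graph that
properly contains the graph of `A` (operators are ordered by inclusion of graphs). -/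
def IsMaximallyMonotone (A : X → Set X) : Prop :=
  Maximal IsMonotone A

/-- The domain `{x | A x ≠ ∅}`. -/
def dom (A : X → Set X) : Set X := {x | (A x).Nonempty}

/-- The range `⋃ x, A x`. -/
def ran (A : X → Set X) : Set X := ⋃ x, A x

/-- The resolvent `J_A = (Id + A)⁻¹`, as a set-valued operator. -/
def resolvent (A : X → Set X) : X → Set X := fun x => {p | x ∈ {p} + A p}

/-- The reflected resolvent `R_A = 2 J_A - Id`, as a set-valued operator. -/
def reflectedResolvent (A : X → Set X) : X → Set X :=
  fun x => (2 : ℝ) • resolvent A x - {x}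

/-- The Douglas–Rachford operator `T = Id - J_A + J_B R_A`, as a set-valued operator
(the composition is that of set-valued operators). It is single-valued with full domain when
`A` and `B` are maximally monotone. -/
def drOperator (A B : X → Set X) : X → Set X :=
  fun x => {x} - resolvent A x + ⋃ z ∈ reflectedResolvent A x, resolvent B z

/-- The displacement operator `Id - T`. -/
def displacement (A B : X → Set X) : X → Set X := fun x => {x} - drOperator A B x

/-- `D = dom A - dom B`. -/
def domDiff (A B : X → Set X) : Set X := dom A - dom B

/-- `R = ran A + ran B`. -/
def ranSum (A B : X → Set X) : Set X := ran A + ran B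

/-- The minimal displacement vector `v`: the projection of `0` onto the closure of
`ran (Id - T)`. -/
noncomputable def v (A B : X → Set X) : X := proj (closure (ran (displacement A B))) 0

/-- `v_D`: the projection of `0` onto the closure of `dom A - dom B`. -/
noncomputable def vD (A B : X → Set X) : X := proj (closure (domDiff A B)) 0

/-- `v_R`: the projection of `0` onto the closure of `ran A + ran B`. -/
noncomputable def vR (A B : X → Set X) : X := proj (closure (ranSum A B)) 0

/-- The solution set `Z = {x | 0 ∈ -v + A x + B (x - v)}` of the normal problem. -/
def Z (A B : X → Set X) : Set X := {x | 0 ∈ {-v A B} + A x + B (x - v A B)}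

/-- The set `Z̃ = {x | 0 ∈ -v_R + A x + B (x - v_D)}`. -/
def ZTilde (A B : X → Set X) : Set X := {x | 0 ∈ {-vR A B} + A x + B (x - vD A B)}

end

end DouglasRachford

namespace DouglasRachford

open Filter Topology

/-! Everything reduces to v = v_D + v_R, with v_D and v_R orthogonal. The form ⟪v_D, ·⟫ is bounded
below on dom A and above on dom B, so -v_D and v_D are recession directions of the closures of ran A
and ran B (`sub_mem_closure_ran`); dually, -v_R is one for the closure of dom B. Hence v_R ± v_D lie
in the closure of R, which forces orthogonality (`inner_vR_vD`), and v_D + v_R lies in both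
closures. By Pythagoras it is the shortest vector there, so it is v (`v_eq_add`).

The inclusions then move selected values along normal directions: a vector normal to the domain at a
point can be added to any value there (`IsMaximallyMonotone.add_mem`), and the same holds for the
inverse operator.

The projections make sense because closures of domains and ranges are convex. This and the recession
lemma come from Minty's theorem, proved here with the Fitzpatrick function. -/

/-- A function `t + ‖z‖² / 2` that is nonnegative on a nonempty closed convex set of pairs `(z, t)`
has a minimizer there, and the minimizer satisfies the variational inequality. -/
theorem exists_variational_of_isClosed_convex {E : Type*} [NormedAddCommGroup E]
    [InnerProductSpace ℝ E] [CompleteSpace E] {C : Set (E × ℝ)} (hne : C.Nonempty)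
    (hcl : IsClosed C) (hcv : Convex ℝ C) (hnn : ∀ p ∈ C, 0 ≤ p.2 + ‖p.1‖ ^ 2 / 2) :
    ∃ p ∈ C, ∀ q ∈ C, 0 ≤ q.2 - p.2 + inner ℝ p.1 (q.1 - p.1) := by
  set g : E × ℝ → ℝ := fun p => p.2 + ‖p.1‖ ^ 2 / 2 with hg
  set m := sInf (g '' C) with hm
  have hbdd : BddBelow (g '' C) := ⟨0, by rintro _ ⟨p, hp, rfl⟩; exact hnn p hp⟩
  have hle : ∀ p ∈ C, m ≤ g p := fun p hp => csInf_le hbdd ⟨p, hp, rfl⟩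
  have hex : ∀ n : ℕ, ∃ p ∈ C, g p < m + 1 / ((n : ℝ) + 1) := fun n => by
    obtain ⟨_, ⟨p, hp, rfl⟩, h⟩ := exists_lt_of_csInf_lt (hne.image g)
      (show sInf (g '' C) < m + 1 / ((n : ℝ) + 1) from
        lt_add_of_pos_right _ Nat.one_div_pos_of_nat)
    exact ⟨p, hp, h⟩
  choose p hpC hpg using hex
  -- The parallelogram law at the midpoint makes the first coordinates of a minimizing sequence
  -- Cauchy; the second coordinates then converge because `g` does.
  have hdist : ∀ a ∈ C, ∀ b ∈ C, ‖a.1 - b.1‖ ^ 2 ≤ 4 * (g a + g b - 2 * m) := by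
    intro a ha b hb
    have hmid := hle _ (hcv ha hb (by norm_num : (0 : ℝ) ≤ 1 / 2)
      (by norm_num : (0 : ℝ) ≤ 1 / 2) (by norm_num))
    have hpar := parallelogram_law_with_norm ℝ a.1 b.1
    have hs : (1 / 2 : ℝ) • a.1 + (1 / 2 : ℝ) • b.1 = (1 / 2 : ℝ) • (a.1 + b.1) := by module
    simp only [hg, Prod.fst_add, Prod.snd_add, Prod.smul_fst, Prod.smul_snd, smul_eq_mul, hs,
      norm_smul, Real.norm_of_nonneg (by norm_num : (0 : ℝ) ≤ 1 / 2)] at hmid ⊢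
    nlinarith
  have hcauchy : CauchySeq fun n => (p n).1 := by
    refine cauchySeq_of_le_tendsto_0 (fun N : ℕ => √(8 * (1 / ((N : ℝ) + 1)))) ?_ ?_
    · intro k l N hk hl
      rw [dist_eq_norm]
      refine Real.le_sqrt_of_sq_le ?_
      have h1 := hdist _ (hpC k) _ (hpC l)
      have h2 := Nat.one_div_le_one_div (α := ℝ) hk
      have h3 := Nat.one_div_le_one_div (α := ℝ) hl
      linarith [hpg k, hpg l]
    · have := ((tendsto_one_div_add_atTop_nhds_zero_nat (𝕜 := ℝ)).const_mul 8).sqrt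
      simpa using this
  obtain ⟨z, hz⟩ := cauchySeq_tendsto_of_complete hcauchy
  have hgm : Tendsto (fun n => g (p n)) atTop (𝓝 m) := by
    refine tendsto_of_tendsto_of_tendsto_of_le_of_le tendsto_const_nhds
      (h := fun n : ℕ => m + 1 / ((n : ℝ) + 1)) ?_ (fun n => hle _ (hpC n)) fun n => (hpg n).le
    simpa using (tendsto_one_div_add_atTop_nhds_zero_nat (𝕜 := ℝ)).const_add m
  have ht : Tendsto (fun n => (p n).2) atTop (𝓝 (m - ‖z‖ ^ 2 / 2)) := by
    refine (hgm.sub ((hz.norm.pow 2).div_const 2)).congr fun n => ?_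
    simp [hg]
  have hzC : (z, m - ‖z‖ ^ 2 / 2) ∈ C :=
    hcl.mem_of_tendsto (hz.prodMk_nhds ht) (Eventually.of_forall hpC)
  refine ⟨_, hzC, fun q hq => ?_⟩
  set c := q.2 - (m - ‖z‖ ^ 2 / 2) + inner ℝ z (q.1 - z) with hc
  -- Minimality along the segment from the minimizer to `q`, divided by `s`; letting `s` tend to 0
  -- gives the inequality.
  have hline : ∀ s : ℝ, 0 < s → s ≤ 1 → 0 ≤ c + s * (‖q.1 - z‖ ^ 2 / 2) := by
    intro s hs hs1
    have h := hle _ (hcv hzC hq (sub_nonneg.2 hs1) hs.le (by ring))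
    have he : (1 - s) • z + s • q.1 = z + s • (q.1 - z) := by module
    simp only [hg, Prod.fst_add, Prod.snd_add, Prod.smul_fst, Prod.smul_snd, smul_eq_mul,
      Prod.smul_mk, he, norm_add_sq_real, inner_smul_right, norm_smul,
      Real.norm_of_nonneg hs.le] at h
    refine nonneg_of_mul_nonneg_right (a := s) ?_ hs
    rw [hc]
    linarith
  have hlim : Tendsto (fun s : ℝ => c + s * (‖q.1 - z‖ ^ 2 / 2)) (𝓝[>] 0) (𝓝 c) := by
    have : Tendsto (fun s : ℝ => c + s * (‖q.1 - z‖ ^ 2 / 2)) (𝓝 0)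
        (𝓝 (c + 0 * (‖q.1 - z‖ ^ 2 / 2))) := by
      apply Continuous.tendsto
      fun_prop
    rw [zero_mul, add_zero] at this
    exact this.mono_left nhdsWithin_le_nhds
  refine ge_of_tendsto hlim ?_
  filter_upwards [Ioc_mem_nhdsGT (zero_lt_one' ℝ)] with s hs
  exact hline s hs.1 hs.2

/-- Used for regularised equations with parameter `l`, whose solutions approach `z` at rate √l. -/
theorem mem_closure_of_forall_norm_sq_le {X : Type*} [SeminormedAddCommGroup X] {S : Set X} {z : X} {K : ℝ}
    (h : ∀ l : ℝ, 0 < l → l ≤ 1 → ∃ x ∈ S, ‖z - x‖ ^ 2 ≤ l * K) : z ∈ closure S := by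
  refine Metric.mem_closure_iff.2 fun e he => ?_
  have hK : 0 < |K| + 1 := by positivity
  -- This `l` makes `l * K` at most e²/2; `|K| + 1` is used since `K` need not be positive.
  obtain ⟨x, hx, hle⟩ := h (min 1 (e ^ 2 / (2 * (|K| + 1)))) (by positivity) (min_le_left _ _)
  refine ⟨x, hx, ?_⟩
  rw [dist_eq_norm]
  refine lt_of_pow_lt_pow_left₀ 2 he.le (hle.trans_lt ?_)
  calc _ ≤ min 1 (e ^ 2 / (2 * (|K| + 1))) * (|K| + 1) := by
        gcongr
        linarith [le_abs_self K]
    _ ≤ e ^ 2 / (2 * (|K| + 1)) * (|K| + 1) := by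
        gcongr
        exact min_le_right _ _
    _ = e ^ 2 / 2 := by field_simp
    _ < e ^ 2 := half_lt_self (by positivity)

theorem mem_closure_of_map_mem_closure₂ {X Y Z : Type*} [TopologicalSpace X] [TopologicalSpace Y]
    [TopologicalSpace Z] {f : X → Y → Z} (hf : Continuous (Function.uncurry f)) {S : Set X}
    {S' : Set Y} {U : Set Z} (h : ∀ x ∈ S, ∀ y ∈ S', f x y ∈ closure U) {x : X} {y : Y}
    (hx : x ∈ closure S) (hy : y ∈ closure S') : f x y ∈ closure U :=
  closure_closure (s := U) ▸ map_mem_closure₂ hf hx hy h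

theorem add_mem_closure_of_forall {X : Type*} [TopologicalSpace X] [Add X] [ContinuousAdd X]
    {S : Set X} {e : X} (h : ∀ x ∈ S, x + e ∈ closure S) {x : X} (hx : x ∈ closure S) :
    x + e ∈ closure S :=
  closure_closure (s := S) ▸ map_mem_closure (f := (· + e)) (continuous_add_const e) hx h

theorem sub_mem_closure_sub {X : Type*} [TopologicalSpace X] [AddGroup X]
    [IsTopologicalAddGroup X] {S S' : Set X} {x y : X} (hx : x ∈ closure S)
    (hy : y ∈ closure S') : x - y ∈ closure (S - S') :=
  map_mem_closure₂ continuous_sub hx hy fun _ ha _ hb => Set.sub_mem_sub ha hb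

theorem add_mem_closure_add {X : Type*} [TopologicalSpace X] [AddGroup X]
    [IsTopologicalAddGroup X] {S S' : Set X} {x y : X} (hx : x ∈ closure S)
    (hy : y ∈ closure S') : x + y ∈ closure (S + S') :=
  map_mem_closure₂ continuous_add hx hy fun _ ha _ hb => Set.add_mem_add ha hb

/-! ### Maximally monotone operators, inverses and normal directions -/

variable {X : Type*} [NormedAddCommGroup X] [InnerProductSpace ℝ X]

/-- Adjoining the pair `(x, u)` to the graph keeps it monotone, so by maximality it was already
there. -/
theorem IsMaximallyMonotone.mem_of_forall {A : X → Set X} (hA : IsMaximallyMonotone A) {x u : X}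
    (h : ∀ y, ∀ w ∈ A y, 0 ≤ inner ℝ (x - y) (u - w)) : u ∈ A x := by
  let A' : X → Set X := fun y => A y ∪ {w | y = x ∧ w = u}
  have hA' : IsMonotone A' := by
    rintro y z a (ha | ⟨rfl, rfl⟩) b (hb | ⟨rfl, rfl⟩)
    · exact hA.1 y z a ha b hb
    · rw [← neg_sub, ← neg_sub b, inner_neg_neg]
      exact h y a ha
    · exact h z b hb
    · simp
  exact hA.2 hA' (fun y w hw => Or.inl hw) x (Or.inr ⟨rfl, rfl⟩)

theorem isMaximallyMonotone_of_forall {A : X → Set X} (hA : IsMonotone A)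
    (h : ∀ x u, (∀ y, ∀ w ∈ A y, 0 ≤ inner ℝ (x - y) (u - w)) → u ∈ A x) :
    IsMaximallyMonotone A :=
  ⟨hA, fun _ hA' hle x u hu => h x u fun y w hw => hA' x y u hu w (hle y hw)⟩

/-- The inverse operator. -/
def inverse {X : Type*} (A : X → Set X) : X → Set X := fun u => {x | u ∈ A x}

theorem IsMaximallyMonotone.inverse {A : X → Set X} (hA : IsMaximallyMonotone A) :
    IsMaximallyMonotone (inverse A) := by
  refine isMaximallyMonotone_of_forall (fun u w x hx y hy => ?_) fun u x h => ?_
  · rw [real_inner_comm]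
    exact hA.1 x y u hx w hy
  · refine hA.mem_of_forall fun y w hw => ?_
    rw [real_inner_comm]
    exact h w y hw

theorem dom_inverse {X : Type*} (A : X → Set X) : dom (inverse A) = ran A := by
  ext u
  simp [dom, ran, inverse, Set.Nonempty]

theorem ran_inverse {X : Type*} (A : X → Set X) : ran (inverse A) = dom A := by
  ext x
  simp [dom, ran, inverse, Set.Nonempty]

theorem IsMaximallyMonotone.dom_nonempty {A : X → Set X} (hA : IsMaximallyMonotone A) :
    (dom A).Nonempty := by
  by_contra hne
  have h : ∀ y w, w ∉ A y := fun y w hw => hne ⟨y, w, hw⟩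
  exact h 0 0 (hA.mem_of_forall fun y w hw => absurd hw (h y w))

theorem IsMaximallyMonotone.ran_nonempty {A : X → Set X} (hA : IsMaximallyMonotone A) :
    (ran A).Nonempty :=
  dom_inverse A ▸ hA.inverse.dom_nonempty

/-- A vector that is normal to the domain at `x` may be added to the values at `x`. -/
theorem IsMaximallyMonotone.add_mem {A : X → Set X} (hA : IsMaximallyMonotone A) {x u n : X}
    (hu : u ∈ A x) (hn : ∀ y ∈ dom A, 0 ≤ inner ℝ n (x - y)) : u + n ∈ A x := by
  refine hA.mem_of_forall fun y w hw => ?_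
  have h1 := hA.1 x y u hu w hw
  have h2 := hn y ⟨w, hw⟩
  rw [add_sub_right_comm, inner_add_right, real_inner_comm n]
  exact add_nonneg h1 h2

/-! ### Minty's theorem, convexity of closures and recession directions -/

section Minty

variable [CompleteSpace X]

/-- `C` is the epigraph of the Fitzpatrick function F. Maximality gives F(x, u) ≥ ⟪x, u⟫, so F plus
half the squared norm is at least ‖x + u‖²/2 ≥ 0 and attains its minimum; the variational inequality
there, tested on the graph, produces the point. -/
theorem IsMaximallyMonotone.exists_neg_mem {A : X → Set X} (hA : IsMaximallyMonotone A) :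
    ∃ x, -x ∈ A x := by
  let C : Set (WithLp 2 (X × X) × ℝ) :=
    {p | ∀ y, ∀ w ∈ A y, inner ℝ p.1.fst w + inner ℝ y p.1.snd - inner ℝ y w ≤ p.2}
  have hcl : IsClosed C := by
    simp only [C, Set.ofPred_forall]
    refine isClosed_iInter fun y => isClosed_iInter fun w => isClosed_iInter fun _ => ?_
    refine isClosed_le ?_ continuous_snd
    have h1 : Continuous fun p : WithLp 2 (X × X) × ℝ => p.1.fst :=
      continuous_fst.comp ((WithLp.prod_continuous_ofLp 2 X X).comp continuous_fst)
    have h2 : Continuous fun p : WithLp 2 (X × X) × ℝ => p.1.snd :=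
      continuous_snd.comp ((WithLp.prod_continuous_ofLp 2 X X).comp continuous_fst)
    fun_prop
  have hcv : Convex ℝ C := by
    intro p hp q hq s t hs ht hst y w hw
    have h1 := mul_le_mul_of_nonneg_left (hp y w hw) hs
    have h2 := mul_le_mul_of_nonneg_left (hq y w hw) ht
    have h3 : inner ℝ y w = s * inner ℝ y w + t * inner ℝ y w := by rw [← add_mul, hst, one_mul]
    simp only [Prod.fst_add, Prod.snd_add, Prod.smul_fst, Prod.smul_snd, WithLp.add_fst,
      WithLp.add_snd, WithLp.smul_fst, WithLp.smul_snd, inner_add_left, inner_add_right,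
      real_inner_smul_left, real_inner_smul_right, smul_eq_mul]
    linarith
  have hgraph : ∀ y, ∀ w ∈ A y, (WithLp.toLp 2 (y, w), inner ℝ y w) ∈ C := by
    intro y w hw y' w' hw'
    have := hA.1 y y' w hw w' hw'
    simp only [inner_sub_left, inner_sub_right] at this
    simp only [WithLp.toLp_fst, WithLp.toLp_snd]
    linarith
  have hge : ∀ p ∈ C, inner ℝ p.1.fst p.1.snd ≤ p.2 := by
    intro p hp
    by_contra! hlt
    have hmem : p.1.snd ∈ A p.1.fst := hA.mem_of_forall fun y w hw => by
      have := hp y w hw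
      simp only [inner_sub_left, inner_sub_right]
      linarith
    have := hp _ _ hmem
    linarith
  have hsq : ∀ p : WithLp 2 (X × X),
      ‖p‖ ^ 2 + 2 * inner ℝ p.fst p.snd = ‖p.fst + p.snd‖ ^ 2 := by
    intro p
    rw [WithLp.prod_norm_sq_eq_of_L2, norm_add_sq_real]
    ring
  obtain ⟨a, b, hab⟩ := hA.dom_nonempty
  obtain ⟨p, hp, hvar⟩ := exists_variational_of_isClosed_convex ⟨_, hgraph a b hab⟩ hcl hcv
    fun p hp => by
      have h1 := hge p hp
      have h2 := hsq p.1
      nlinarith [sq_nonneg ‖p.1.fst + p.1.snd‖]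
  have key : ∀ y, ∀ w ∈ A y,
      ‖p.1.fst + p.1.snd‖ ^ 2 ≤ inner ℝ (-p.1.snd - y) (-p.1.fst - w) := by
    intro y w hw
    have h1 := hvar _ (hgraph y w hw)
    have h2 := hge p hp
    have h3 := hsq p.1
    rw [inner_sub_right, real_inner_self_eq_norm_sq, WithLp.prod_inner_apply] at h1
    simp only [WithLp.ofLp_fst, WithLp.ofLp_snd] at h1
    simp only [inner_sub_left, inner_sub_right, inner_neg_left, inner_neg_right]
    rw [real_inner_comm y, real_inner_comm p.1.fst p.1.snd] at *
    linarith
  have hmem : -p.1.fst ∈ A (-p.1.snd) :=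
    hA.mem_of_forall fun y w hw => (sq_nonneg _).trans (key y w hw)
  -- Testing `key` at the graph point just found makes its right side vanish.
  have h0 := key _ _ hmem
  rw [sub_self, inner_zero_left] at h0
  have h1 : p.1.fst + p.1.snd = 0 :=
    norm_eq_zero.1 (pow_eq_zero_iff two_ne_zero |>.1 (h0.antisymm (sq_nonneg _)))
  exact ⟨p.1.fst, by rwa [← eq_neg_of_add_eq_zero_left h1] at hmem⟩

/-- **Minty's theorem**: `x + l A x ∋ z` is solvable for every `z` and every `l > 0`. -/
theorem IsMaximallyMonotone.exists_add_smul_eq {A : X → Set X} (hA : IsMaximallyMonotone A)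
    {l : ℝ} (hl : 0 < l) (z : X) : ∃ x, ∃ u ∈ A x, x + l • u = z := by
  -- Chosen so that `-x ∈ A' x` says exactly that `l⁻¹ • (z - x) ∈ A x`.
  let A' : X → Set X := fun x => {w | l⁻¹ • (w + z) ∈ A x}
  have hA' : IsMaximallyMonotone A' := by
    refine isMaximallyMonotone_of_forall (fun x y u hu w hw => ?_) fun x u h => ?_
    · have := hA.1 x y _ hu _ hw
      rw [← smul_sub, add_sub_add_right_eq_sub, inner_smul_right] at this
      exact nonneg_of_mul_nonneg_right this (inv_pos.2 hl)
    · refine hA.mem_of_forall fun y w hw => ?_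
      have := h y (l • w - z) (show l⁻¹ • (l • w - z + z) ∈ A y by
        rwa [sub_add_cancel, inv_smul_smul₀ hl.ne'])
      have he : l⁻¹ • (u + z) - w = l⁻¹ • (u - (l • w - z)) := by
        rw [smul_sub, smul_sub, inv_smul_smul₀ hl.ne', smul_add]
        abel
      rw [he, inner_smul_right]
      exact mul_nonneg (inv_pos.2 hl).le this
  obtain ⟨x, hx⟩ := hA'.exists_neg_mem
  exact ⟨x, _, hx, by rw [smul_inv_smul₀ hl.ne']; abel⟩

theorem IsMaximallyMonotone.convex_closure_dom {A : X → Set X} (hA : IsMaximallyMonotone A) :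
    Convex ℝ (closure (dom A)) := by
  intro a ha b hb s t hs ht hst
  refine mem_closure_of_map_mem_closure₂ (f := fun a b : X => s • a + t • b) (by fun_prop) ?_ ha hb
  rintro a ⟨a', ha'⟩ b ⟨b', hb'⟩
  set z := s • a + t • b with hz
  -- The resolvent points `x` of `z` tend to `z`: monotonicity against `a` and `b`, averaged with
  -- weights `s` and `t`, bounds ‖z - x‖² by `l` times an affine function of `z - x`. Young's
  -- inequality and `l ≤ 1` absorb the linear term and yield `K`.
  refine mem_closure_of_forall_norm_sq_le (K := ‖s • a' + t • b'‖ ^ 2 -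
    2 * (s * inner ℝ (z - a) a' + t * inner ℝ (z - b) b')) fun l hl hl1 => ?_
  obtain ⟨x, u, hu, hx⟩ := hA.exists_add_smul_eq hl z
  refine ⟨x, ⟨u, hu⟩, ?_⟩
  have hzx : z - x = l • u := by rw [← hx, add_sub_cancel_left]
  have h1 := mul_nonneg hs (mul_nonneg hl.le (hA.1 x a u hu a' ha'))
  have h2 := mul_nonneg ht (mul_nonneg hl.le (hA.1 x b u hu b' hb'))
  have hsq : ‖z - x‖ ^ 2 =
      -(l * (s * inner ℝ (x - a) u + t * inner ℝ (x - b) u)) := by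
    have he : z - x = -(s • (x - a) + t • (x - b)) := by
      rw [hz, ← sub_eq_iff_eq_add'.2 hst.symm]
      module
    rw [← real_inner_self_eq_norm_sq]
    nth_rw 2 [hzx]
    rw [he, inner_smul_right, inner_neg_left, inner_add_left, real_inner_smul_left,
      real_inner_smul_left]
    ring
  have hsplit : s * inner ℝ (x - a) a' + t * inner ℝ (x - b) b' =
      (s * inner ℝ (z - a) a' + t * inner ℝ (z - b) b') - inner ℝ (z - x) (s • a' + t • b') := by
    simp only [inner_sub_left, inner_add_right, inner_smul_right]
    ring
  rw [inner_sub_right] at h1 h2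
  have h3 : inner ℝ (z - x) (s • a' + t • b') ≤ (‖z - x‖ ^ 2 + ‖s • a' + t • b'‖ ^ 2) / 2 := by
    have := norm_sub_sq_real (z - x) (s • a' + t • b')
    nlinarith [sq_nonneg ‖z - x - (s • a' + t • b')‖]
  have h4 : ‖z - x‖ ^ 2 ≤ l * (inner ℝ (z - x) (s • a' + t • b') -
      (s * inner ℝ (z - a) a' + t * inner ℝ (z - b) b')) := by
    rw [← neg_sub (_ + _) (inner ℝ (z - x) _), ← hsplit, hsq]
    linarith
  have h5 := mul_le_mul_of_nonneg_left h3 hl.le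
  have h6 := mul_le_mul_of_nonneg_right hl1 (sq_nonneg ‖z - x‖)
  linarith

theorem IsMaximallyMonotone.convex_closure_ran {A : X → Set X} (hA : IsMaximallyMonotone A) :
    Convex ℝ (closure (ran A)) :=
  dom_inverse A ▸ hA.inverse.convex_closure_dom

/-- If `⟪d, ·⟫` is bounded below on the domain, then `-d` is a recession direction of the closure
of the range. -/
theorem IsMaximallyMonotone.sub_mem_closure_ran {A : X → Set X} (hA : IsMaximallyMonotone A)
    {d : X} {c : ℝ} (hd : ∀ x ∈ dom A, c ≤ inner ℝ d x) {u : X} (hu : u ∈ ran A) :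
    u - d ∈ closure (ran A) := by
  obtain ⟨y, hy⟩ := Set.mem_iUnion.1 hu
  refine mem_closure_of_forall_norm_sq_le (K := 2 * (inner ℝ d y - c) + ‖y‖ ^ 2) fun l hl hl1 => ?_
  -- The error is `l • x`. Monotonicity against `(y, u)` and the lower bound `c` keep `l * ‖x‖ ^ 2`
  -- bounded by `K`, so the squared error is at most `l * K`.
  obtain ⟨w, x, hx, hw⟩ := hA.inverse.exists_add_smul_eq hl (u - d)
  refine ⟨w, Set.mem_iUnion.2 ⟨x, hx⟩, ?_⟩
  have h1 := hA.1 x y w hx u hy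
  have h2 := hd x ⟨w, hx⟩
  have he : w - u = -(d + l • x) := by rw [← sub_eq_zero, ← sub_eq_zero.2 hw]; abel
  rw [← hw, add_sub_cancel_left, norm_smul, Real.norm_of_nonneg hl.le]
  rw [he, inner_neg_right, inner_add_right, inner_smul_right, inner_sub_left, inner_sub_left,
    real_inner_self_eq_norm_sq, real_inner_comm d x, real_inner_comm d y] at h1
  have h3 : inner ℝ y x ≤ (‖x‖ ^ 2 + ‖y‖ ^ 2) / 2 := by
    have := norm_sub_sq_real y x
    nlinarith [sq_nonneg ‖y - x‖]
  have h4 := mul_le_mul_of_nonneg_left h3 hl.le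
  have h5 : l * ‖x‖ ^ 2 ≤ 2 * (inner ℝ d y - c) + ‖y‖ ^ 2 := by
    nlinarith [mul_le_mul_of_nonneg_right hl1 (sq_nonneg ‖y‖)]
  nlinarith

theorem IsMaximallyMonotone.sub_mem_closure_dom {A : X → Set X} (hA : IsMaximallyMonotone A)
    {d : X} {c : ℝ} (hd : ∀ u ∈ ran A, c ≤ inner ℝ d u) {x : X} (hx : x ∈ dom A) :
    x - d ∈ closure (dom A) := by
  rw [← dom_inverse] at hd
  rw [← ran_inverse] at hx ⊢
  exact hA.inverse.sub_mem_closure_ran hd hx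

theorem convex_closure_domDiff {A B : X → Set X} (hA : IsMaximallyMonotone A)
    (hB : IsMaximallyMonotone B) : Convex ℝ (closure (domDiff A B)) := by
  have h : closure (domDiff A B) = closure (closure (dom A) - closure (dom B)) := by
    refine (closure_mono (Set.sub_subset_sub subset_closure subset_closure)).antisymm
      (closure_minimal ?_ isClosed_closure)
    rintro _ ⟨x, hx, y, hy, rfl⟩
    exact sub_mem_closure_sub hx hy
  exact h ▸ (hA.convex_closure_dom.sub hB.convex_closure_dom).closure

theorem convex_closure_ranSum {A B : X → Set X} (hA : IsMaximallyMonotone A)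
    (hB : IsMaximallyMonotone B) : Convex ℝ (closure (ranSum A B)) := by
  have h : closure (ranSum A B) = closure (closure (ran A) + closure (ran B)) := by
    refine (closure_mono (Set.add_subset_add subset_closure subset_closure)).antisymm
      (closure_minimal ?_ isClosed_closure)
    rintro _ ⟨x, hx, y, hy, rfl⟩
    exact add_mem_closure_add hx hy
  exact h ▸ (hA.convex_closure_ran.add hB.convex_closure_ran).closure

theorem isProj_vD {A B : X → Set X} (hA : IsMaximallyMonotone A) (hB : IsMaximallyMonotone B) :
    IsProj (closure (domDiff A B)) 0 (vD A B) :=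
  isProj_proj (hA.dom_nonempty.sub hB.dom_nonempty).closure isClosed_closure
    (convex_closure_domDiff hA hB) 0

theorem isProj_vR {A B : X → Set X} (hA : IsMaximallyMonotone A) (hB : IsMaximallyMonotone B) :
    IsProj (closure (ranSum A B)) 0 (vR A B) :=
  isProj_proj (hA.ran_nonempty.add hB.ran_nonempty).closure isClosed_closure
    (convex_closure_ranSum hA hB) 0

end Minty

theorem IsProj.norm_sq_le_inner {C : Set X} (hcv : Convex ℝ C) {p : X} (hp : IsProj C 0 p)
    {y : X} (hy : y ∈ C) : ‖p‖ ^ 2 ≤ inner ℝ p y := by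
  have : Nonempty C := ⟨⟨p, hp.1⟩⟩
  have hinf : ‖0 - p‖ = ⨅ w : C, ‖0 - (w : X)‖ :=
    le_antisymm (le_ciInf fun w => hp.2 w w.2)
      (ciInf_le ⟨0, by rintro _ ⟨z, rfl⟩; exact norm_nonneg _⟩ (⟨p, hp.1⟩ : C))
  have h := (norm_eq_iInf_iff_real_inner_le_zero hcv hp.1).1 hinf y hy
  rw [zero_sub, inner_neg_left, inner_sub_right, real_inner_self_eq_norm_sq] at h
  linarith

/-! ### Geometry of v_D and v_R -/

section

variable [CompleteSpace X] {A B : X → Set X}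

theorem norm_vD_sq_le (hA : IsMaximallyMonotone A) (hB : IsMaximallyMonotone B) {x y : X}
    (hx : x ∈ dom A) (hy : y ∈ dom B) : ‖vD A B‖ ^ 2 ≤ inner ℝ (vD A B) (x - y) :=
  (isProj_vD hA hB).norm_sq_le_inner (convex_closure_domDiff hA hB)
    (subset_closure (Set.sub_mem_sub hx hy))

theorem norm_vR_sq_le (hA : IsMaximallyMonotone A) (hB : IsMaximallyMonotone B) {u w : X}
    (hu : u ∈ ran A) (hw : w ∈ ran B) : ‖vR A B‖ ^ 2 ≤ inner ℝ (vR A B) (u + w) :=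
  (isProj_vR hA hB).norm_sq_le_inner (convex_closure_ranSum hA hB)
    (subset_closure (Set.add_mem_add hu hw))

/-- Fixing one point of `dom B` turns the variational inequality for v_D into a lower bound of ⟪v_D,
·⟫ on `dom A`. -/
theorem sub_vD_mem_closure_ran (hA : IsMaximallyMonotone A) (hB : IsMaximallyMonotone B) {u : X}
    (hu : u ∈ ran A) : u - vD A B ∈ closure (ran A) := by
  obtain ⟨y, hy⟩ := hB.dom_nonempty
  refine hA.sub_mem_closure_ran (c := ‖vD A B‖ ^ 2 + inner ℝ (vD A B) y) (fun x hx => ?_) hu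
  have := norm_vD_sq_le hA hB hx hy
  rw [inner_sub_right] at this
  linarith

theorem add_vD_mem_closure_ran (hA : IsMaximallyMonotone A) (hB : IsMaximallyMonotone B) {w : X}
    (hw : w ∈ ran B) : w + vD A B ∈ closure (ran B) := by
  obtain ⟨x, hx⟩ := hA.dom_nonempty
  rw [← sub_neg_eq_add]
  refine hB.sub_mem_closure_ran (c := ‖vD A B‖ ^ 2 - inner ℝ (vD A B) x) (fun y hy => ?_) hw
  have := norm_vD_sq_le hA hB hx hy
  rw [inner_sub_right] at this
  rw [inner_neg_left]
  linarith

theorem sub_vR_mem_closure_dom (hA : IsMaximallyMonotone A) (hB : IsMaximallyMonotone B)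
    {y : X} (hy : y ∈ dom B) : y - vR A B ∈ closure (dom B) := by
  obtain ⟨u, hu⟩ := hA.ran_nonempty
  refine hB.sub_mem_closure_dom (c := ‖vR A B‖ ^ 2 - inner ℝ (vR A B) u) (fun w hw => ?_) hy
  have := norm_vR_sq_le hA hB hu hw
  rw [inner_add_right] at this
  linarith

theorem vD_add_vR_mem_closure_domDiff (hA : IsMaximallyMonotone A) (hB : IsMaximallyMonotone B) :
    vD A B + vR A B ∈ closure (domDiff A B) := by
  refine add_mem_closure_of_forall ?_ (isProj_vD hA hB).1
  rintro _ ⟨x, hx, y, hy, rfl⟩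
  rw [sub_add]
  exact sub_mem_closure_sub (subset_closure hx) (sub_vR_mem_closure_dom hA hB hy)

theorem vR_add_vD_mem_closure_ranSum (hA : IsMaximallyMonotone A) (hB : IsMaximallyMonotone B) :
    vR A B + vD A B ∈ closure (ranSum A B) := by
  refine add_mem_closure_of_forall ?_ (isProj_vR hA hB).1
  rintro _ ⟨u, hu, w, hw, rfl⟩
  rw [add_assoc]
  exact add_mem_closure_add (subset_closure hu) (add_vD_mem_closure_ran hA hB hw)

theorem vR_sub_vD_mem_closure_ranSum (hA : IsMaximallyMonotone A) (hB : IsMaximallyMonotone B) :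
    vR A B - vD A B ∈ closure (ranSum A B) := by
  rw [sub_eq_add_neg]
  refine add_mem_closure_of_forall ?_ (isProj_vR hA hB).1
  rintro _ ⟨u, hu, w, hw, rfl⟩
  rw [← sub_eq_add_neg, add_sub_right_comm]
  exact add_mem_closure_add (sub_vD_mem_closure_ran hA hB hu) (subset_closure hw)

/-- Both v_R + v_D and v_R - v_D lie in the closure of R, so the variational inequality for v_R
bounds the inner product from both sides. -/
theorem inner_vR_vD (hA : IsMaximallyMonotone A) (hB : IsMaximallyMonotone B) :
    inner ℝ (vR A B) (vD A B) = 0 := by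
  have h1 := (isProj_vR hA hB).norm_sq_le_inner (convex_closure_ranSum hA hB)
    (vR_add_vD_mem_closure_ranSum hA hB)
  have h2 := (isProj_vR hA hB).norm_sq_le_inner (convex_closure_ranSum hA hB)
    (vR_sub_vD_mem_closure_ranSum hA hB)
  rw [inner_add_right, real_inner_self_eq_norm_sq] at h1
  rw [inner_sub_right, real_inner_self_eq_norm_sq] at h2
  linarith

/-- The minimal displacement vector is the sum of `v_D` and `v_R`. -/
theorem v_eq_add (hA : IsMaximallyMonotone A) (hB : IsMaximallyMonotone B)
    (h : closure (ran (displacement A B)) = closure (domDiff A B) ∩ closure (ranSum A B)) :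
    v A B = vD A B + vR A B := by
  have hcv := (convex_closure_domDiff hA hB).inter (convex_closure_ranSum hA hB)
  have hcl : IsClosed (closure (domDiff A B) ∩ closure (ranSum A B)) :=
    isClosed_closure.inter isClosed_closure
  have hmem : vD A B + vR A B ∈ closure (domDiff A B) ∩ closure (ranSum A B) :=
    ⟨vD_add_vR_mem_closure_domDiff hA hB, add_comm (vD A B) _ ▸ vR_add_vD_mem_closure_ranSum hA hB⟩
  rw [v, h]
  refine (isProj_proj ⟨_, hmem⟩ hcl hcv 0).eq hcv ⟨hmem, fun y hy => ?_⟩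
  have h1 := (isProj_vD hA hB).norm_sq_le_inner (convex_closure_domDiff hA hB) hy.1
  have h2 := (isProj_vR hA hB).norm_sq_le_inner (convex_closure_ranSum hA hB) hy.2
  have h3 : ‖vD A B + vR A B‖ ^ 2 = ‖vD A B‖ ^ 2 + ‖vR A B‖ ^ 2 := by
    rw [norm_add_sq_real, real_inner_comm, inner_vR_vD hA hB]
    ring
  -- By orthogonality, the two variational inequalities add up to the one for the sum;
  -- Cauchy–Schwarz then compares norms.
  have h4 : ‖vD A B + vR A B‖ ^ 2 ≤ ‖vD A B + vR A B‖ * ‖y‖ := by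
    refine le_trans ?_ (real_inner_le_norm _ _)
    rw [h3, inner_add_left]
    exact add_le_add h1 h2
  rw [zero_sub, zero_sub, norm_neg, norm_neg]
  nlinarith [norm_nonneg (vD A B + vR A B), norm_nonneg y]

/-! ### Comparison of the two solution sets -/

theorem zero_mem_neg_add_add_iff {X : Type*} [AddCommGroup X] {c : X} {S S' : Set X} :
    0 ∈ {-c} + S + S' ↔ ∃ a ∈ S, ∃ b ∈ S', a + b = c := by
  simp only [Set.mem_add, Set.mem_singleton_iff]
  constructor
  · rintro ⟨_, ⟨_, rfl, a, ha, rfl⟩, b, hb, h⟩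
    exact ⟨a, ha, b, hb, by rwa [add_assoc, neg_add_eq_zero, eq_comm] at h⟩
  · rintro ⟨a, ha, b, hb, rfl⟩
    exact ⟨_, ⟨_, rfl, a, ha, rfl⟩, b, hb, by abel⟩

/-- If `x - v_D ∈ dom B`, then `-v_D` is normal to `dom A` at `x`. -/
theorem sub_vD_mem (hA : IsMaximallyMonotone A) (hB : IsMaximallyMonotone B) {x a : X}
    (ha : a ∈ A x) (hx : x - vD A B ∈ dom B) : a - vD A B ∈ A x := by
  rw [sub_eq_add_neg]
  refine hA.add_mem ha fun y hy => ?_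
  have := norm_vD_sq_le hA hB hy hx
  rw [sub_sub_eq_add_sub, add_sub_right_comm, inner_add_right, real_inner_self_eq_norm_sq] at this
  rw [inner_neg_left, ← inner_neg_right, neg_sub]
  linarith

/-- If `x ∈ dom A`, then `v_D` is normal to `dom B` at `x - v_D`. -/
theorem add_vD_mem (hA : IsMaximallyMonotone A) (hB : IsMaximallyMonotone B) {x b : X}
    (hx : x ∈ dom A) (hb : b ∈ B (x - vD A B)) : b + vD A B ∈ B (x - vD A B) := by
  refine hB.add_mem hb fun y hy => ?_
  have := norm_vD_sq_le hA hB hx hy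
  rw [sub_right_comm, inner_sub_right, real_inner_self_eq_norm_sq]
  linarith

/-- With `a + b = v_R`, replacing `b` by `b + v_D` makes the sum v. It remains to move the base
point by -v_R: `b` minimizes ⟪v_R, ·⟫ over `ran B` and v_D ⟂ v_R, so -v_R is normal to `ran B` at `b
+ v_D`, and can be added to the base point as a value of the inverse. -/
theorem ZTilde_subset_Z (hA : IsMaximallyMonotone A) (hB : IsMaximallyMonotone B)
    (hv : v A B = vD A B + vR A B) : ZTilde A B ⊆ Z A B := by
  intro x hx
  obtain ⟨a, ha, b, hb, hab⟩ := zero_mem_neg_add_add_iff.1 hx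
  refine zero_mem_neg_add_add_iff.2 ⟨a, ha, b + vD A B, ?_, by rw [hv, ← hab]; abel⟩
  have hb' : x - vD A B ∈ inverse B (b + vD A B) := add_vD_mem hA hB ⟨a, ha⟩ hb
  rw [hv, ← sub_sub, sub_eq_add_neg _ (vR A B)]
  refine hB.inverse.add_mem hb' fun w hw => ?_
  rw [dom_inverse] at hw
  have h1 := norm_vR_sq_le hA hB (Set.mem_iUnion.2 ⟨x, ha⟩) hw
  have h2 := real_inner_self_eq_norm_sq (vR A B)
  nth_rw 2 [← hab] at h2
  rw [inner_add_right] at h1 h2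
  rw [inner_neg_left, inner_sub_right, inner_add_right, inner_vR_vD hA hB]
  linarith

/-- Here `a + b = v_D`, and normality of -v_D lets `a` absorb it, leaving sum 0. -/
theorem Z_subset_ZTilde (hA : IsMaximallyMonotone A) (hB : IsMaximallyMonotone B)
    (hv : v A B = vD A B) (hR : vR A B = 0) : Z A B ⊆ ZTilde A B := by
  intro x hx
  obtain ⟨a, ha, b, hb, hab⟩ := zero_mem_neg_add_add_iff.1 hx
  rw [hv] at hb hab
  refine zero_mem_neg_add_add_iff.2 ⟨_, sub_vD_mem hA hB ha ⟨b, hb⟩, b, hb, ?_⟩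
  rw [hR, ← hab]
  abel

end

end DouglasRachford

theorem mainTheorem4 {X : Type*} [NormedAddCommGroup X] [InnerProductSpace ℝ X] [CompleteSpace X]
    (A B : X → Set X)
    (hA : DouglasRachford.IsMaximallyMonotone A) (hB : DouglasRachford.IsMaximallyMonotone B)
    (hran : closure (DouglasRachford.ran (DouglasRachford.displacement A B)) =
      closure (DouglasRachford.domDiff A B ∩ DouglasRachford.ranSum A B))
    (hDR : closure (DouglasRachford.domDiff A B ∩ DouglasRachford.ranSum A B) =
      closure (DouglasRachford.domDiff A B) ∩ closure (DouglasRachford.ranSum A B)) :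
    DouglasRachford.ZTilde A B ⊆ DouglasRachford.Z A B ∧
      (DouglasRachford.vR A B = 0 → DouglasRachford.ZTilde A B = DouglasRachford.Z A B) := by
  have hv := DouglasRachford.v_eq_add hA hB (hran.trans hDR)
  have hsub := DouglasRachford.ZTilde_subset_Z hA hB hv
  refine ⟨hsub, fun hR => hsub.antisymm (DouglasRachford.Z_subset_ZTilde hA hB ?_ hR)⟩
  rw [hv, hR, add_zero]
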